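/- Let $d, D$ be natural numbers and let $V$ be an isotropically random $d$-dimensional linear subspace of $\mathbb R^D$, i.e. a random linear subspace of $\mathbb R^D$ (measurable for the Borel $\sigma$-algebra obtained by identifying a subspace with the orthogonal projection onto it) which almost surely has dimension $d$ and whose law is invariant under every orthogonal transformation of $\mathbb R^D$. Let $v$ be a random vector in $\mathbb R^D$, defined on the same probability space and otherwise arbitrarily dependent on $V$, such that almost surely $\|v\|_2 = 1$ and $v \in V$. Then $v$ is integrable and $$\big\| \mathbb E[v] \big\|_2 \;\le\; 1150 \sqrt{\frac{d \,\ln(1+d)}{D}} .$$ -/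

import Mathlib

open MeasureTheory ProbabilityTheory

/-- The σ-algebra on the linear subspaces of `ℝ^D`: a subspace is identified with the orthogonal
projection onto it, and the Borel σ-algebra of the operator norm is pulled back. On the
`d`-dimensional subspaces this is the Borel σ-algebra of the Grassmannian, with the metric
`‖P_V - P_W‖`. -/
noncomputable instance Submodule.instMeasurableSpaceEuclidean (D : ℕ) :
    MeasurableSpace (Submodule ℝ (EuclideanSpace ℝ (Fin D))) :=
  MeasurableSpace.comap (fun V => V.starProjection)
    (borel (EuclideanSpace ℝ (Fin D) →L[ℝ] EuclideanSpace ℝ (Fin D)))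

/-- `V` is an isotropically random `d`-dimensional subspace of `ℝ^D`: a random subspace, almost
surely of dimension `d`, whose law is invariant under every orthogonal transformation of `ℝ^D`. -/
structure IsIsotropicSubspace {Ω : Type*} [MeasurableSpace Ω] (μ : Measure Ω) (d D : ℕ)
    (V : Ω → Submodule ℝ (EuclideanSpace ℝ (Fin D))) : Prop where
  aemeasurable : AEMeasurable V μ
  finrank_eq : ∀ᵐ ω ∂μ, Module.finrank ℝ (V ω) = d
  map_isometry : ∀ O : EuclideanSpace ℝ (Fin D) ≃ₗᵢ[ℝ] EuclideanSpace ℝ (Fin D),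
    IdentDistrib (fun ω => (V ω).map O.toLinearEquiv.toLinearMap) V μ μ

/-! Put u = E v, w = u/‖u‖, and let P be the projection onto V. Since v is a unit vector of V, ‖u‖ =
E⟨w, v⟩ = E⟨P w, v⟩ ≤ E‖P w‖, hence ‖u‖² ≤ E‖P w‖². By isotropy this last mean is the same for all
unit w; over an orthonormal basis these means add up to E tr P = d, so each is d/D. Thus ‖E v‖ ≤
√(d/D), stronger than the claim: the logarithm and the constant 1150 are slack. -/

/-- The quadratic form of the orthogonal projection onto a subspace, as a measurable function of
the subspace. -/
theorem measurable_inner_starProjection {D : ℕ} (w : EuclideanSpace ℝ (Fin D)) :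
    Measurable fun W : Submodule ℝ (EuclideanSpace ℝ (Fin D)) =>
      inner ℝ (W.starProjection w) w := by
  let _ : MeasurableSpace (EuclideanSpace ℝ (Fin D) →L[ℝ] EuclideanSpace ℝ (Fin D)) := borel _
  have _ : BorelSpace (EuclideanSpace ℝ (Fin D) →L[ℝ] EuclideanSpace ℝ (Fin D)) := ⟨rfl⟩
  have hT : Continuous fun T : EuclideanSpace ℝ (Fin D) →L[ℝ] EuclideanSpace ℝ (Fin D) =>
      inner ℝ (T w) w := by fun_prop
  exact hT.measurable.comp (comap_measurable _)

theorem Submodule.inner_starProjection_self {E : Type*} [NormedAddCommGroup E]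
    [InnerProductSpace ℝ E] (W : Submodule ℝ E) [W.HasOrthogonalProjection] (w : E) :
    inner ℝ (W.starProjection w) w = ‖W.starProjection w‖ ^ 2 := by
  rw [← real_inner_self_eq_norm_sq, Submodule.inner_starProjection_left_eq_right,
    Submodule.inner_starProjection_left_eq_right,
    Submodule.starProjection_eq_self_iff.mpr (W.starProjection_apply_mem w)]

/-- The sum is the trace of the projection in the basis `b`, and the trace of a projection is its
rank. -/
theorem Submodule.sum_inner_starProjection {D : ℕ} (W : Submodule ℝ (EuclideanSpace ℝ (Fin D)))
    {ι : Type*} [Fintype ι] (b : OrthonormalBasis ι ℝ (EuclideanSpace ℝ (Fin D))) :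
    ∑ i, inner ℝ (W.starProjection (b i)) (b i) = (Module.finrank ℝ W : ℝ) := by
  have hp : LinearMap.IsProj W W.starProjection.toLinearMap :=
    ⟨fun x => W.starProjection_apply_mem x,
      fun x hx => Submodule.starProjection_eq_self_iff.mpr hx⟩
  rw [← hp.trace, LinearMap.trace_eq_sum_inner _ b]
  exact Finset.sum_congr rfl fun i _ => real_inner_comm _ _

section

variable {Ω : Type*} [MeasurableSpace Ω] {μ : Measure Ω} {d D : ℕ}
  {V : Ω → Submodule ℝ (EuclideanSpace ℝ (Fin D))}

theorem IsIsotropicSubspace.integrable_inner_starProjection [IsProbabilityMeasure μ]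
    (hV : IsIsotropicSubspace μ d D V)
    (w : EuclideanSpace ℝ (Fin D)) :
    Integrable (fun ω => inner ℝ ((V ω).starProjection w) w) μ := by
  refine Integrable.of_bound
    ((measurable_inner_starProjection w).comp_aemeasurable hV.aemeasurable).aestronglyMeasurable
    (‖w‖ * ‖w‖) (Filter.Eventually.of_forall fun ω => ?_)
  exact (norm_inner_le_norm _ _).trans
    (mul_le_mul_of_nonneg_right ((V ω).norm_starProjection_apply_le w) (norm_nonneg _))

/-- Vectors of equal norm are exchanged by a hyperplane reflection O. As the projection onto O V is
O P O⁻¹, invariance of the law under O equates the two means. -/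
theorem IsIsotropicSubspace.integral_inner_starProjection_eq_of_norm_eq (hV : IsIsotropicSubspace μ d D V)
    {w w' : EuclideanSpace ℝ (Fin D)} (h : ‖w‖ = ‖w'‖) :
    ∫ ω, inner ℝ ((V ω).starProjection w) w ∂μ =
      ∫ ω, inner ℝ ((V ω).starProjection w') w' ∂μ := by
  set O := (ℝ ∙ (w - w'))ᗮ.reflection
  have hO : O w = w' := Submodule.reflection_sub h
  have hs : O.symm w' = w := by rw [← hO, O.symm_apply_apply]
  refine Eq.trans (integral_congr_ae (Filter.Eventually.of_forall fun ω => ?_))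
    ((hV.map_isometry O).comp (measurable_inner_starProjection w')).integral_eq
  have hmap := Submodule.starProjection_map_apply O (V ω) w'
  rw [hs] at hmap
  calc inner ℝ ((V ω).starProjection w) w = inner ℝ (O ((V ω).starProjection w)) w' := by
        rw [← hO, O.inner_map_map]
    _ = _ := congrArg (fun x => inner ℝ x w') hmap.symm

/-- The mean squared length of the projection of a unit vector is `d / D`. -/
theorem IsIsotropicSubspace.integral_inner_starProjection [IsProbabilityMeasure μ]
    (hV : IsIsotropicSubspace μ d D V)
    {w : EuclideanSpace ℝ (Fin D)} (hw : ‖w‖ = 1) :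
    ∫ ω, inner ℝ ((V ω).starProjection w) w ∂μ = d / D := by
  -- `ℝ^0` contains no unit vector.
  have hD : (D : ℝ) ≠ 0 := by
    rintro h
    obtain rfl : D = 0 := by exact_mod_cast h
    simp [Subsingleton.elim w 0] at hw
  let b := EuclideanSpace.basisFun (Fin D) ℝ
  have hsum : ∫ ω, ∑ i, inner ℝ ((V ω).starProjection (b i)) (b i) ∂μ = d := by
    have : (fun ω => ∑ i, inner ℝ ((V ω).starProjection (b i)) (b i)) =ᵐ[μ] fun _ => (d : ℝ) := by
      filter_upwards [hV.finrank_eq] with ω hω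
      rw [(V ω).sum_inner_starProjection b, hω]
    rw [integral_congr_ae this]
    simp
  rw [integral_finsetSum _ fun i _ => hV.integrable_inner_starProjection (b i),
    Finset.sum_congr rfl fun i _ => hV.integral_inner_starProjection_eq_of_norm_eq
      (w' := w) ((b.norm_eq_one i).trans hw.symm)] at hsum
  simp only [Finset.sum_const, Finset.card_univ, Fintype.card_fin, nsmul_eq_mul] at hsum
  rw [eq_div_iff hD, mul_comm, hsum]

/-- The mean of a random unit vector of an isotropically random subspace has length at most
`√(d / D)`. -/
theorem IsIsotropicSubspace.norm_integral_le [IsProbabilityMeasure μ]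
    (hV : IsIsotropicSubspace μ d D V)
    {v : Ω → EuclideanSpace ℝ (Fin D)} (hv : Integrable v μ)
    (hv_unit : ∀ᵐ ω ∂μ, ‖v ω‖ = 1) (hv_mem : ∀ᵐ ω ∂μ, v ω ∈ V ω) :
    ‖∫ ω, v ω ∂μ‖ ≤ Real.sqrt (d / D) := by
  set u := ∫ ω, v ω ∂μ with hu
  rcases eq_or_ne u 0 with h0 | h0
  · rw [h0, norm_zero]
    exact Real.sqrt_nonneg _
  have hu0 : 0 < ‖u‖ := norm_pos_iff.mpr h0
  let w := ‖u‖⁻¹ • u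
  have hw : ‖w‖ = 1 := norm_smul_inv_norm h0
  have huw : ‖u‖ = ∫ ω, inner ℝ w (v ω) ∂μ := by
    rw [integral_inner hv w, ← hu, real_inner_smul_left, real_inner_self_eq_norm_sq]
    field_simp
  have hint : Integrable (fun ω => inner ℝ w (v ω)) μ := hv.const_inner w
  refine Real.le_sqrt_of_sq_le ?_
  -- integrate `2 t x ≤ t² + x²` with `t = ‖u‖`
  have hle : ∫ ω, 2 * ‖u‖ * inner ℝ w (v ω) ∂μ ≤
      ∫ ω, (‖u‖ ^ 2 + inner ℝ ((V ω).starProjection w) w) ∂μ := by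
    refine integral_mono_ae (hint.const_mul _)
      ((integrable_const _).add (hV.integrable_inner_starProjection w)) ?_
    filter_upwards [hv_unit, hv_mem] with ω h1 h2
    have hproj : inner ℝ w (v ω) = inner ℝ ((V ω).starProjection w) (v ω) := by
      rw [Submodule.inner_starProjection_left_eq_right,
        Submodule.starProjection_eq_self_iff.mpr h2]
    have hcs : inner ℝ w (v ω) ≤ ‖(V ω).starProjection w‖ := by
      rw [hproj]
      simpa [h1] using real_inner_le_norm ((V ω).starProjection w) (v ω)
    simp only [Submodule.inner_starProjection_self]
    nlinarith [sq_nonneg (‖u‖ - ‖(V ω).starProjection w‖)]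
  rw [integral_const_mul, ← huw, integral_add (integrable_const _) (hV.integrable_inner_starProjection w),
    hV.integral_inner_starProjection hw] at hle
  simp only [integral_const, probReal_univ, one_smul] at hle
  linarith

end

theorem mainTheorem2 {Ω : Type*} [MeasurableSpace Ω] (μ : Measure Ω) [IsProbabilityMeasure μ]
    (d D : ℕ) (V : Ω → Submodule ℝ (EuclideanSpace ℝ (Fin D)))
    (hV : IsIsotropicSubspace μ d D V)
    (v : Ω → EuclideanSpace ℝ (Fin D)) (hv : AEMeasurable v μ)
    (hv_unit : ∀ᵐ ω ∂μ, ‖v ω‖ = 1) (hv_mem : ∀ᵐ ω ∂μ, v ω ∈ V ω) :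
    Integrable v μ ∧
      ‖∫ ω, v ω ∂μ‖ ≤ 1150 * Real.sqrt ((d : ℝ) * Real.log (1 + (d : ℝ)) / (D : ℝ)) := by
  have hint : Integrable v μ :=
    Integrable.of_bound hv.aestronglyMeasurable 1 (hv_unit.mono fun ω h => h.le)
  refine ⟨hint, (hV.norm_integral_le hint hv_unit hv_mem).trans ?_⟩
  -- At d = 0 the logarithm vanishes, but so does √(d/D).
  rcases Nat.eq_zero_or_pos d with rfl | hd
  · simp
  have hd1 : (1 : ℝ) ≤ d := by exact_mod_cast hd
  -- For d ≥ 1 the logarithm is at least ln 2 > 1/2, and 1150² / 2 ≥ 1 makes up for this factor.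
  have hlog : (1 / 2 : ℝ) ≤ Real.log (1 + d) := by
    have h2 : Real.log 2 ≤ Real.log (1 + d) := Real.log_le_log (by norm_num) (by linarith)
    linarith [Real.log_two_gt_d9]
  have h0 : (0 : ℝ) ≤ d / D := by positivity
  refine Real.sqrt_le_iff.mpr ⟨by positivity, ?_⟩
  rw [mul_pow, mul_div_right_comm, Real.sq_sqrt (mul_nonneg h0 (by linarith))]
  nlinarith [mul_le_mul_of_nonneg_left hlog h0]
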